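/- **Proposition.** Let $P, Q, \Delta \ge 0$ be real. Consider the real-valued channel with state, without public discussion, $$ y_r = x + s + z_r, \qquad y_e = x + s + z_e, $$ where $s \sim \mathcal N(0,Q)$, $z_r \sim \mathcal N(0,1)$ and $z_e \sim \mathcal N(0,1+\Delta)$ are i.i.d. over the channel uses, $z_r^n$ and $z_e^n$ are independent of each other, and $(z_r^n,z_e^n)$ is independent of the state sequence and of the sender's randomness. A code of block length $n$ works as follows. The sender knows the whole state sequence $s^n$ and draws a random variable $u$ from a conditional distribution $p_{u|s^n}$. It sends $x^n = f_n(u,s^n)$, subject to the average power constraint $\frac1n\sum_{i=1}^n E[x_i^2] \le P$. The receiver observes $y_r^n$ and the eavesdropper observes $y_e^n$. The sender computes the key $k = g_n(u,s^n)$ and the receiver computes $l = h_n(y_r^n)$; both keys take values in a finite set $\mathcal K_n$. A rate $R$ is achievable if there are a sequence of such codes, a sequence $\varepsilon_n \to 0$ and a constant $c$ such that for all $n \ge 1$ $$ |\mathcal K_n| \le 2^{cn},\quad \Pr(k \ne l) \le \varepsilon_n,\quad \tfrac1n H(k) \ge R - \varepsilon_n,\quad \tfrac1n I(k;y_e^n)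 \le \varepsilon_n . $$ The secret-key capacity is the supremum of the achievable rates. All logarithms, entropies and mutual informations are in base $2$. Then the secret-key capacity is at most $$ \frac12\log\left(1+\frac{\Delta\,(P+Q+2\sqrt{PQ})}{P+Q+1+\Delta+2\sqrt{PQ}}\right). $$ -/

import Mathlib

open MeasureTheory ProbabilityTheory Filter Topology
open scoped NNReal ENNReal ProbabilityTheory

noncomputable section

namespace DirtyPaper

/-- Shannon entropy, in bits, of a random variable `X` with values in a finite set. -/
def entropy {Ω A : Type*} [MeasurableSpace Ω] [Fintype A] (μ : Measure Ω) (X : Ω → A) : ℝ :=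
  -∑ a : A, μ.real (X ⁻¹' {a}) * Real.logb 2 (μ.real (X ⁻¹' {a}))

/-- Mutual information `I(X; Y)`, in bits: the relative entropy of the joint law of `(X, Y)`
with respect to the product of the marginal laws (`klDiv` is measured in nats). -/
def mutualInfo {Ω A B : Type*} [MeasurableSpace Ω] [MeasurableSpace A] [MeasurableSpace B]
    (μ : Measure Ω) (X : Ω → A) (Y : Ω → B) : ℝ≥0∞ :=
  InformationTheory.klDiv (μ.map (fun ω => (X ω, Y ω))) ((μ.map X).prod (μ.map Y)) /
    ENNReal.ofReal (Real.log 2)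

/-- A secret-key code of block length `n`, without public discussion, over a real-valued channel
with a real-valued state. The sender knows the whole state sequence `s` and draws `u` from the
conditional distribution `randomizer s`. -/
structure KeyCode (n : ℕ) where
  /-- The alphabet of the sender's random variable `u`. -/
  U : Type
  /-- The σ-algebra on that alphabet. -/
  measU : MeasurableSpace U
  /-- The conditional distribution of `u` given the state sequence. -/
  randomizer : Kernel (Fin n → ℝ) U
  markov : IsMarkovKernel randomizer
  /-- The number of possible keys. -/
  keyCard : ℕ
  /-- The channel input sequence as a function of `(u, s)`. -/
  encoder : U → (Fin n → ℝ) → (Fin n → ℝ)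
  measurable_encoder : Measurable (fun p : U × (Fin n → ℝ) => encoder p.1 p.2)
  /-- The sender's key as a function of `(u, s)`. -/
  senderKey : U → (Fin n → ℝ) → Fin keyCard
  measurable_senderKey : Measurable (fun p : U × (Fin n → ℝ) => senderKey p.1 p.2)
  /-- The receiver's key as a function of the receiver's output sequence. -/
  receiverKey : (Fin n → ℝ) → Fin keyCard
  measurable_receiverKey : Measurable receiverKey

attribute [instance] KeyCode.measU KeyCode.markov

namespace KeyCode

variable {n : ℕ}

/-- Outcomes `((s, u), (z_r, z_e))`: state sequence, sender's randomness, and the noise sequences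
at the receiver and at the eavesdropper. -/
abbrev Outcome (C : KeyCode n) : Type :=
  ((Fin n → ℝ) × C.U) × ((Fin n → ℝ) × (Fin n → ℝ))

/-- The law of the outcomes: the state is i.i.d. `N(0, Q)`, `u` is drawn given the state, and the
noises, i.i.d. `N(0, 1)` and i.i.d. `N(0, 1 + Δ)`, are independent of each other and of `(s, u)`.
The second parameter of `gaussianReal` is the variance. -/
def law (C : KeyCode n) (Q Δ : ℝ≥0) : Measure C.Outcome :=
  ((Measure.pi fun _ : Fin n => gaussianReal 0 Q) ⊗ₘ C.randomizer).prod
    ((Measure.pi fun _ : Fin n => gaussianReal 0 1).prod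
      (Measure.pi fun _ : Fin n => gaussianReal 0 (1 + Δ)))

/-- Channel input `x`. -/
def input (C : KeyCode n) (ω : C.Outcome) : Fin n → ℝ :=
  C.encoder ω.1.2 ω.1.1

/-- Receiver's output `y_r = x + s + z_r`. -/
def outputR (C : KeyCode n) (ω : C.Outcome) : Fin n → ℝ :=
  C.input ω + ω.1.1 + ω.2.1

/-- Eavesdropper's output `y_e = x + s + z_e`. -/
def outputE (C : KeyCode n) (ω : C.Outcome) : Fin n → ℝ :=
  C.input ω + ω.1.1 + ω.2.2

/-- The sender's key `k`. -/
def keyK (C : KeyCode n) (ω : C.Outcome) : Fin C.keyCard :=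
  C.senderKey ω.1.2 ω.1.1

/-- The receiver's key `l`. -/
def keyL (C : KeyCode n) (ω : C.Outcome) : Fin C.keyCard :=
  C.receiverKey (C.outputR ω)

/-- Average power constraint `(1/n) ∑ᵢ E[xᵢ²] ≤ P`. -/
def PowerConstraint (C : KeyCode n) (P Q Δ : ℝ≥0) : Prop :=
  (∀ i, Integrable (fun ω => C.input ω i ^ 2) (C.law Q Δ)) ∧
    (∑ i, ∫ ω, C.input ω i ^ 2 ∂(C.law Q Δ)) / n ≤ P

end KeyCode

/-- `R` (in bits per channel use) is an achievable secret-key rate without public discussion for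
the channel `y_r = x + s + z_r`, `y_e = x + s + z_e` under the power constraint `P`. The size of
the key alphabet is at most exponential in the block length, at an exponent that the
sequence of codes may choose. -/
def Achievable (P Q Δ : ℝ≥0) (R : ℝ) : Prop :=
  ∃ (C : ∀ n : ℕ, KeyCode n) (ε : ℕ → ℝ) (c : ℝ), Tendsto ε atTop (𝓝 0) ∧
    ∀ n : ℕ, 0 < n →
      (C n).PowerConstraint P Q Δ ∧
      ((C n).keyCard : ℝ) ≤ 2 ^ (c * n) ∧
      ((C n).law Q Δ).real {ω | (C n).keyK ω ≠ (C n).keyL ω} ≤ ε n ∧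
      R - ε n ≤ entropy ((C n).law Q Δ) (C n).keyK / n ∧
      mutualInfo ((C n).law Q Δ) (C n).keyK (C n).outputE / n ≤ ENNReal.ofReal (ε n)

/-- The secret-key capacity without public discussion, in bits per channel use: the supremum of
the achievable rates. -/
def secretKeyCapacity (P Q Δ : ℝ≥0) : EReal :=
  sSup {r : EReal | ∃ R : ℝ, Achievable P Q Δ R ∧ r = R}

end DirtyPaper

end

/-! Write `V = x + s`, `Z = V + E` for the eavesdropper's output and `Y` for the receiver's.
Reliability and secrecy make the rate essentially the equivocation `H(K) - I(K; Z) = H(K | Z)` per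
letter. This quantity and the error probability involve only the laws of `(K, Z)` and `(K, Y)`, so
the two noises may be coupled at will: `Y = V + c E + W` with `W` Gaussian of variance `τ`,
independent of `(V, E)`, and `c ^ 2 (1 + Δ) + τ = 1`.

Classically, `H(K | Z) ≤ I(V; Y | Z) + H(K | Y)`. Fano's inequality controls the last term, and the
first is at most `n / 2 * log (b / τ)` when a linear estimate `a Z` of `Y` has mean square error at
most `b` per letter. Since the power of `V` is at most `q = (√P + √Q) ^ 2`, the degraded coupling `c
= 1 / (1 + Δ)` and the best linear coefficient for power `q` give the stated bound.

The proof avoids differential and conditional entropies through one Gibbs inequality,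
`equivocation_le`. A guess of the key from `Z` is built by drawing `Y` around `a Z` with variance
`b`, decoding it, and hedging with `decisionWeight`; its logarithmic loss yields the Gaussian and
Fano terms together (`equivocation_le_decision`, `equivocation_le_gaussian`).
`sum_integral_add_sq_le` supplies the power bound, and `equivocation_le_capacityBound` chooses the
parameters. -/

namespace DirtyPaper

/-! ### Gibbs inequality for the equivocation -/

/-- If `∫ exp X ≤ 1` then `∫ X ≤ 0`. -/
lemma integral_nonpos_of_lintegral_exp_le_one {Ω : Type*} [MeasurableSpace Ω] {μ : Measure Ω}
    [IsProbabilityMeasure μ] {X : Ω → ℝ} (hX : Integrable X μ)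
    (h : ∫⁻ ω, ENNReal.ofReal (Real.exp (X ω)) ∂μ ≤ 1) : ∫ ω, X ω ∂μ ≤ 0 := by
  have hm : AEStronglyMeasurable (fun ω => Real.exp (X ω)) μ :=
    Real.continuous_exp.comp_aestronglyMeasurable hX.1
  have hint : Integrable (fun ω => Real.exp (X ω)) μ := by
    refine ⟨hm, ?_⟩
    rw [hasFiniteIntegral_iff_ofReal (Eventually.of_forall fun _ => (Real.exp_pos _).le)]
    exact h.trans_lt ENNReal.one_lt_top
  have h1 : ∫ ω, Real.exp (X ω) ∂μ ≤ 1 := by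
    rw [integral_eq_lintegral_of_nonneg_ae (Eventually.of_forall fun _ => (Real.exp_pos _).le) hm]
    exact ENNReal.toReal_le_of_le_ofReal zero_le_one (by simpa using h)
  have h2 : ∫ ω, (X ω + 1) ∂μ ≤ ∫ ω, Real.exp (X ω) ∂μ :=
    integral_mono (hX.add (integrable_const _)) hint fun ω => Real.add_one_le_exp _
  rw [integral_add hX (integrable_const _)] at h2
  simp at h2
  linarith

lemma entropy_mul_log_two {Ω A : Type*} [MeasurableSpace Ω] [Fintype A] [MeasurableSpace A]
    [MeasurableSingletonClass A] (μ : Measure Ω) [IsFiniteMeasure μ] {K : Ω → A}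
    (hK : Measurable K) :
    entropy μ K * Real.log 2 = ∫ ω, -Real.log (μ.real (K ⁻¹' {K ω})) ∂μ := by
  have h2 : Real.log 2 ≠ 0 := (Real.log_pos (by norm_num)).ne'
  have hmap := integral_map (μ := μ) hK.aemeasurable
    (f := fun k => -Real.log (μ.real (K ⁻¹' {k})))
    (measurable_of_finite _).aestronglyMeasurable
  rw [← hmap, integral_fintype .of_finite, entropy, neg_mul, Finset.sum_mul,
    ← Finset.sum_neg_distrib]
  refine Finset.sum_congr rfl fun k _ => ?_
  rw [map_measureReal_apply hK (measurableSet_singleton k), Real.logb, smul_eq_mul]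
  field_simp

/-- Equality fails only at `x = 0`, where `Real.log 0 = 0` makes the left side zero. This lets
densities and atoms cancel without positivity assumptions. -/
lemma mul_ofReal_exp_neg_log_le_one {x : ℝ≥0∞} (hx : x ≠ ∞) :
    x * ENNReal.ofReal (Real.exp (-Real.log x.toReal)) ≤ 1 := by
  rcases eq_or_ne x 0 with rfl | h0
  · simp
  · have hp : 0 < x.toReal := ENNReal.toReal_pos h0 hx
    rw [Real.exp_neg, Real.exp_log hp, ENNReal.ofReal_inv_of_pos hp, ENNReal.ofReal_toReal hx,
      ENNReal.mul_inv_cancel h0 hx]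

/-- A Gibbs-type lower bound on the relative entropy of a joint law with respect to the product of
the marginals: the equivocation `H(K) - I(K; Z)` (in nats) is at most `-E T` as soon as `exp T`,
averaged given `(K, Z)`, is at most `Φ (K, Z)` with `∑ k, Φ (k, z) ≤ 1`. -/
lemma equivocation_le {Ω A B : Type*} [MeasurableSpace Ω] [MeasurableSpace A] [MeasurableSpace B]
    [Fintype A] [MeasurableSingletonClass A] {μ : Measure Ω} [IsProbabilityMeasure μ]
    {K : Ω → A} {Z : Ω → B} (hK : Measurable K) (hZ : Measurable Z)
    (hfin : InformationTheory.klDiv (μ.map fun ω => (K ω, Z ω)) ((μ.map K).prod (μ.map Z)) ≠ ∞)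
    {T : Ω → ℝ} (hT : Integrable T μ) {Φ : A × B → ℝ≥0∞} (hΦ : Measurable Φ)
    (hΦ1 : ∀ z, ∑ k, Φ (k, z) ≤ 1)
    (hTΦ : ∀ g : A × B → ℝ≥0∞, Measurable g →
      ∫⁻ ω, g (K ω, Z ω) * ENNReal.ofReal (Real.exp (T ω)) ∂μ ≤
        ∫⁻ ω, g (K ω, Z ω) * Φ (K ω, Z ω) ∂μ) :
    entropy μ K * Real.log 2 -
      (InformationTheory.klDiv (μ.map fun ω => (K ω, Z ω))
        ((μ.map K).prod (μ.map Z))).toReal ≤ -∫ ω, T ω ∂μ := by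
  have hKZ : Measurable fun ω => (K ω, Z ω) := hK.prodMk hZ
  have : IsProbabilityMeasure (μ.map K) := Measure.isProbabilityMeasure_map hK.aemeasurable
  have : IsProbabilityMeasure (μ.map Z) := Measure.isProbabilityMeasure_map hZ.aemeasurable
  have : IsProbabilityMeasure (μ.map fun ω => (K ω, Z ω)) :=
    Measure.isProbabilityMeasure_map hKZ.aemeasurable
  set J := μ.map fun ω => (K ω, Z ω) with hJ
  set π := (μ.map K).prod (μ.map Z) with hπ
  obtain ⟨hac, hint⟩ := InformationTheory.klDiv_ne_top_iff.1 hfin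
  set L : A × B → ℝ := llr J π with hL
  have hLm : Measurable L := measurable_llr J π
  set p : A → ℝ := fun k => Real.log (μ.real (K ⁻¹' {k})) with hp
  have hpm : Measurable p := measurable_of_finite _
  have hLint : Integrable (fun ω => L (K ω, Z ω)) μ :=
    (integrable_map_measure hLm.aestronglyMeasurable hKZ.aemeasurable).1 hint
  have hpint : Integrable (fun ω => p (K ω)) μ :=
    (integrable_map_measure hpm.aestronglyMeasurable hK.aemeasurable).1 .of_finite
  have hkl : (InformationTheory.klDiv J π).toReal = ∫ ω, L (K ω, Z ω) ∂μ := by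
    rw [InformationTheory.toReal_klDiv_of_measure_eq hac (by simp), hJ,
      integral_map hKZ.aemeasurable hLm.aestronglyMeasurable]
  have hTp : Integrable (fun ω => T ω - p (K ω)) μ := hT.sub hpint
  have hX : Integrable (fun ω => T ω - p (K ω) - L (K ω, Z ω)) μ := hTp.sub hLint
  -- Where the density is positive, `g` is the reciprocal of the conditional probability of `K`
  -- given `Z`.
  set g : A × B → ℝ≥0∞ := fun x => ENNReal.ofReal (Real.exp (-L x)) *
    ENNReal.ofReal (Real.exp (-p x.1)) with hg
  have hgm : Measurable g := by
    have : Measurable fun x : A × B => p x.1 := hpm.comp measurable_fst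
    fun_prop
  have key : ∫⁻ ω, ENNReal.ofReal (Real.exp (T ω - p (K ω) - L (K ω, Z ω))) ∂μ ≤ 1 := calc
    _ = ∫⁻ ω, g (K ω, Z ω) * ENNReal.ofReal (Real.exp (T ω)) ∂μ := by
        refine lintegral_congr fun ω => ?_
        simp only [hg]
        rw [← ENNReal.ofReal_mul (Real.exp_pos _).le, ← ENNReal.ofReal_mul (by positivity),
          ← Real.exp_add, ← Real.exp_add]
        congr 2
        ring
    _ ≤ ∫⁻ ω, g (K ω, Z ω) * Φ (K ω, Z ω) ∂μ := hTΦ g hgm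
    _ = ∫⁻ x, g x * Φ x ∂J := (lintegral_map (hgm.mul hΦ) hKZ).symm
    _ = ∫⁻ x, J.rnDeriv π x * (g x * Φ x) ∂π :=
        (lintegral_rnDeriv_mul hac (hgm.mul hΦ).aemeasurable).symm
    _ ≤ ∫⁻ x, ENNReal.ofReal (Real.exp (-p x.1)) * Φ x ∂π := by
        refine lintegral_mono_ae ?_
        filter_upwards [J.rnDeriv_ne_top π] with x hx
        calc _ = (J.rnDeriv π x * ENNReal.ofReal (Real.exp (-Real.log (J.rnDeriv π x).toReal))) *
              (ENNReal.ofReal (Real.exp (-p x.1)) * Φ x) := by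
              simp only [hg, hL, llr]; ring
          _ ≤ 1 * (ENNReal.ofReal (Real.exp (-p x.1)) * Φ x) := by
              gcongr
              exact mul_ofReal_exp_neg_log_le_one hx
          _ = _ := one_mul _
    _ = ∑ k, (∫⁻ z, ENNReal.ofReal (Real.exp (-p k)) * Φ (k, z) ∂(μ.map Z)) * (μ.map K) {k} := by
        have : Measurable fun x : A × B => p x.1 := hpm.comp measurable_fst
        rw [hπ, lintegral_prod _ (by fun_prop), lintegral_fintype]
    -- The mass of `{k}` cancels against `exp (-p k)`; keys of mass zero only lose.
    _ ≤ ∑ k, ∫⁻ z, Φ (k, z) ∂(μ.map Z) := by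
        refine Finset.sum_le_sum fun k _ => ?_
        rw [lintegral_const_mul _ (by fun_prop), mul_right_comm, mul_comm (ENNReal.ofReal _)]
        refine mul_le_of_le_one_left zero_le ?_
        rw [Measure.map_apply hK (measurableSet_singleton k)]
        exact mul_ofReal_exp_neg_log_le_one (measure_ne_top _ _)
    _ = ∫⁻ z, ∑ k, Φ (k, z) ∂(μ.map Z) := (lintegral_finsetSum _ fun k _ => by fun_prop).symm
    _ ≤ ∫⁻ _, 1 ∂(μ.map Z) := lintegral_mono hΦ1
    _ = 1 := by simp
  have hfinal := integral_nonpos_of_lintegral_exp_le_one hX key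
  rw [integral_sub hTp hLint, integral_sub hT hpint] at hfinal
  rw [hkl, entropy_mul_log_two μ hK, integral_neg]
  linarith

/-! ### Gaussian product laws: densities and second moments -/

/-- The law of `n` i.i.d. centred Gaussian variables of variance `v`. -/
noncomputable abbrev iidGaussian (n : ℕ) (v : ℝ≥0) : Measure (Fin n → ℝ) :=
  Measure.pi fun _ : Fin n => gaussianReal 0 v

/-- The density of `iidGaussian n v`. -/
noncomputable def iidGaussianPDF (n : ℕ) (v : ℝ≥0) (x : Fin n → ℝ) : ℝ :=
  ∏ i, gaussianPDFReal 0 v (x i)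

variable {n : ℕ}

@[fun_prop]
lemma measurable_iidGaussianPDF (v : ℝ≥0) : Measurable (iidGaussianPDF n v) :=
  Finset.measurable_prod _ fun i _ =>
    (measurable_gaussianPDFReal 0 v).comp (measurable_pi_apply i)

lemma iidGaussianPDF_pos {v : ℝ≥0} (hv : v ≠ 0) (x : Fin n → ℝ) : 0 < iidGaussianPDF n v x :=
  Finset.prod_pos fun _ _ => gaussianPDFReal_pos _ _ _ hv

/-- It suffices to compare the measures of boxes. The indicator of a box is a product over
coordinates, so Fubini factors the integral of the density. -/
lemma iidGaussian_eq_withDensity {v : ℝ≥0} (hv : v ≠ 0) :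
    iidGaussian n v =
      (volume : Measure (Fin n → ℝ)).withDensity fun x => ENNReal.ofReal (iidGaussianPDF n v x) := by
  refine Measure.pi_eq fun s hs => ?_
  have hind (x : Fin n → ℝ) : (Set.univ.pi s).indicator (iidGaussianPDF n v) x =
      ∏ i, (s i).indicator (gaussianPDFReal 0 v) (x i) := by
    classical
    by_cases hx : x ∈ Set.univ.pi s
    · rw [Set.indicator_of_mem hx]
      exact Finset.prod_congr rfl fun i _ => (Set.indicator_of_mem (hx i trivial) _).symm
    · rw [Set.indicator_of_notMem hx]
      simp only [Set.mem_pi, Set.mem_univ, forall_const, not_forall] at hx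
      obtain ⟨i, hi⟩ := hx
      exact (Finset.prod_eq_zero (Finset.mem_univ i) (Set.indicator_of_notMem hi _)).symm
  have hint (i : Fin n) : Integrable ((s i).indicator (gaussianPDFReal 0 v)) :=
    (integrable_gaussianPDFReal 0 v).indicator (hs i)
  have hint' : Integrable fun x : Fin n → ℝ => ∏ i, (s i).indicator (gaussianPDFReal 0 v) (x i) :=
    Integrable.fintype_prod hint
  rw [withDensity_apply _ (MeasurableSet.univ_pi hs),
    ← lintegral_indicator (MeasurableSet.univ_pi hs)]
  calc _ = ∫⁻ x : Fin n → ℝ, ENNReal.ofReal (∏ i, (s i).indicator (gaussianPDFReal 0 v) (x i)) := by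
        refine lintegral_congr fun x => ?_
        rw [← hind]
        by_cases hx : x ∈ Set.univ.pi s
        · simp only [Set.indicator_of_mem hx]
        · simp only [Set.indicator_of_notMem hx, ENNReal.ofReal_zero]
    _ = ENNReal.ofReal (∏ i, ∫ x, (s i).indicator (gaussianPDFReal 0 v) x) := by
        rw [← integral_fintype_prod_volume_eq_prod
          (f := fun i : Fin n => (s i).indicator (gaussianPDFReal 0 v)),
          ofReal_integral_eq_lintegral_ofReal hint']
        exact Eventually.of_forall fun x => Finset.prod_nonneg fun i _ =>
          Set.indicator_nonneg (fun _ _ => gaussianPDFReal_nonneg _ _ _) _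
    _ = _ := by
        rw [ENNReal.ofReal_prod_of_nonneg fun i _ => integral_nonneg fun x =>
          Set.indicator_nonneg (fun _ _ => gaussianPDFReal_nonneg _ _ _) _]
        refine Finset.prod_congr rfl fun i _ => ?_
        rw [gaussianReal_apply_eq_integral 0 hv, integral_indicator (hs i)]

lemma lintegral_iidGaussianPDF {v : ℝ≥0} (hv : v ≠ 0) :
    ∫⁻ x, ENNReal.ofReal (iidGaussianPDF n v x) = 1 := by
  have h : iidGaussian n v Set.univ = 1 := measure_univ
  rwa [iidGaussian_eq_withDensity hv, withDensity_apply _ .univ, Measure.restrict_univ] at h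

/-- Change of measure from a translated Gaussian law to another Gaussian density. -/
lemma lintegral_iidGaussian_mul_div {v v' : ℝ≥0} (hv : v ≠ 0) {f : (Fin n → ℝ) → ℝ≥0∞}
    (hf : Measurable f) (m c : Fin n → ℝ) :
    ∫⁻ w, f (m + w) * ENNReal.ofReal (iidGaussianPDF n v' (m + w - c) / iidGaussianPDF n v w)
        ∂iidGaussian n v =
      ∫⁻ y, f y * ENNReal.ofReal (iidGaussianPDF n v' (y - c)) := by
  rw [iidGaussian_eq_withDensity hv, lintegral_withDensity_eq_lintegral_mul _ (by fun_prop)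
    (by fun_prop), ← lintegral_add_left_eq_self (fun y => f y * _) m]
  refine lintegral_congr fun w => ?_
  have hw := iidGaussianPDF_pos hv w
  rw [Pi.mul_apply, mul_left_comm, ← ENNReal.ofReal_mul hw.le, mul_div_cancel₀ _ hw.ne']

lemma log_iidGaussianPDF {v : ℝ≥0} (hv : v ≠ 0) (x : Fin n → ℝ) :
    Real.log (iidGaussianPDF n v x) =
      -(n / 2 * Real.log (2 * Real.pi * v)) - (∑ i, x i ^ 2) / (2 * v) := by
  have hpos : (0 : ℝ) < 2 * Real.pi * v := by positivity
  rw [iidGaussianPDF, Real.log_prod fun i _ => (gaussianPDFReal_pos _ _ _ hv).ne']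
  have (i : Fin n) : Real.log (gaussianPDFReal 0 v (x i)) =
      -(Real.log (2 * Real.pi * v) / 2) - x i ^ 2 / (2 * v) := by
    rw [gaussianPDFReal, Real.log_mul (by positivity) (by positivity), Real.log_exp, Real.log_inv,
      Real.log_sqrt hpos.le]
    ring
  simp only [this, Finset.sum_sub_distrib, Finset.sum_div]
  simp
  ring

lemma integrable_log_iidGaussianPDF {Ω : Type*} [MeasurableSpace Ω] {μ : Measure Ω}
    [IsProbabilityMeasure μ] {v : ℝ≥0} (hv : v ≠ 0) {D : Ω → Fin n → ℝ}
    (hD : ∀ i, MemLp (fun ω => D ω i) 2 μ) :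
    Integrable (fun ω => Real.log (iidGaussianPDF n v (D ω))) μ := by
  simp only [log_iidGaussianPDF hv]
  exact (integrable_const _).sub
    ((integrable_finsetSum _ fun i _ => (hD i).integrable_sq).div_const _)

lemma integral_log_iidGaussianPDF {Ω : Type*} [MeasurableSpace Ω] {μ : Measure Ω}
    [IsProbabilityMeasure μ] {v : ℝ≥0} (hv : v ≠ 0) {D : Ω → Fin n → ℝ}
    (hD : ∀ i, MemLp (fun ω => D ω i) 2 μ) :
    ∫ ω, Real.log (iidGaussianPDF n v (D ω)) ∂μ =
      -(n / 2 * Real.log (2 * Real.pi * v)) - (∑ i, ∫ ω, D ω i ^ 2 ∂μ) / (2 * v) := by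
  simp only [log_iidGaussianPDF hv]
  have h := integrable_finsetSum Finset.univ fun i _ => (hD i).integrable_sq
  rw [integral_sub (integrable_const _) (h.div_const _), integral_div,
    integral_finsetSum _ fun i _ => (hD i).integrable_sq]
  simp

lemma memLp_eval_iidGaussian (v : ℝ≥0) (i : Fin n) : MemLp (fun x => x i) 2 (iidGaussian n v) :=
  (memLp_id_gaussianReal' 2 (by simp)).comp_measurePreserving
    (measurePreserving_eval (fun _ : Fin n => gaussianReal 0 v) i)

lemma integral_eval_iidGaussian (v : ℝ≥0) (i : Fin n) : ∫ x, x i ∂iidGaussian n v = 0 := by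
  have h := (measurePreserving_eval (fun _ : Fin n => gaussianReal 0 v) i).map_eq
  have := integral_map (μ := iidGaussian n v) (measurable_pi_apply i).aemeasurable
    (f := fun y : ℝ => y) measurable_id.aestronglyMeasurable
  rw [← this]
  exact (congrArg (fun ν => ∫ y, y ∂ν) h).trans integral_id_gaussianReal

lemma integral_sq_gaussianReal (v : ℝ≥0) : ∫ y, y ^ 2 ∂gaussianReal 0 v = v := by
  rw [← variance_of_integral_eq_zero (X := fun y => y) measurable_id.aemeasurable
    integral_id_gaussianReal, variance_fun_id_gaussianReal]

lemma integral_eval_sq_iidGaussian (v : ℝ≥0) (i : Fin n) :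
    ∫ x, x i ^ 2 ∂iidGaussian n v = v := by
  have h := (measurePreserving_eval (fun _ : Fin n => gaussianReal 0 v) i).map_eq
  have := integral_map (μ := iidGaussian n v) (measurable_pi_apply i).aemeasurable
    (f := fun y : ℝ => y ^ 2) (by fun_prop)
  rw [← this]
  exact (congrArg (fun ν => ∫ y, y ^ 2 ∂ν) h).trans (integral_sq_gaussianReal v)

lemma map_const_mul_add_gaussianReal (c : ℝ) (v₁ v₂ v : ℝ≥0) (hv : c ^ 2 * v₁ + v₂ = (v : ℝ)) :
    ((gaussianReal 0 v₁).prod (gaussianReal 0 v₂)).map (fun p => c * p.1 + p.2) =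
      gaussianReal 0 v := by
  obtain ⟨w, hw⟩ : ∃ w : ℝ≥0, w = NNReal.mk (c ^ 2) (sq_nonneg c) * v₁ := ⟨_, rfl⟩
  have h1 : (gaussianReal 0 v₁).map (fun x => c * x) = gaussianReal 0 w := by
    rw [hw, gaussianReal_map_const_mul, mul_zero]
  have h2 : ((gaussianReal 0 v₁).prod (gaussianReal 0 v₂)).map (Prod.map (fun x => c * x) id) =
      (gaussianReal 0 w).prod (gaussianReal 0 v₂) := by
    rw [← Measure.map_prod_map _ _ (by fun_prop) measurable_id, h1, Measure.map_id]
  have h3 := gaussianReal_conv_gaussianReal (m₁ := 0) (m₂ := 0) (v₁ := w) (v₂ := v₂)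
  have hwv : w + v₂ = v := by
    apply NNReal.eq
    rw [NNReal.coe_add, hw, NNReal.coe_mul, ← hv]
    rfl
  rw [Measure.conv, ← h2, Measure.map_map (by fun_prop) (by fun_prop), hwv, add_zero] at h3
  exact h3

/-- With `v = 1`, this recovers the law of the receiver's noise from the eavesdropper's noise and an
independent innovation. -/
lemma map_smul_add_iidGaussian (c : ℝ) (v₁ v₂ v : ℝ≥0) (hv : c ^ 2 * v₁ + v₂ = (v : ℝ)) :
    ((iidGaussian n v₁).prod (iidGaussian n v₂)).map (fun p => c • p.1 + p.2) =
      iidGaussian n v := by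
  rw [← (measurePreserving_arrowProdEquivProdArrow ℝ ℝ (Fin n) (fun _ => gaussianReal 0 v₁)
    fun _ => gaussianReal 0 v₂).map_eq, Measure.map_map (by fun_prop) (by fun_prop)]
  have := Measure.pi_map_pi (μ := fun _ : Fin n => (gaussianReal 0 v₁).prod (gaussianReal 0 v₂))
    (f := fun _ p => c * p.1 + p.2)
    (hμ := fun _ => by rw [map_const_mul_add_gaussianReal c v₁ v₂ v hv]; infer_instance)
    (fun _ => by fun_prop)
  simp only [map_const_mul_add_gaussianReal c v₁ v₂ v hv] at this
  exact this

/-- Second moment of the sum of two independent variables, one of them centred. -/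
lemma integral_prod_add_sq {α β : Type*} [MeasurableSpace α] [MeasurableSpace β]
    {μ : Measure α} {ν : Measure β} [IsProbabilityMeasure μ] [IsProbabilityMeasure ν]
    {f : α → ℝ} {g : β → ℝ} (hf : MemLp f 2 μ) (hg : MemLp g 2 ν) (hg0 : ∫ b, g b ∂ν = 0) :
    ∫ x, (f x.1 + g x.2) ^ 2 ∂μ.prod ν = ∫ a, f a ^ 2 ∂μ + ∫ b, g b ^ 2 ∂ν := by
  have h1 : Integrable (fun x : α × β => f x.1 ^ 2) (μ.prod ν) := hf.integrable_sq.comp_fst ν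
  have h2 : Integrable (fun x : α × β => g x.2 ^ 2) (μ.prod ν) := hg.integrable_sq.comp_snd μ
  have h3 : Integrable (fun x : α × β => 2 * (f x.1 * g x.2)) (μ.prod ν) :=
    ((hf.integrable (by norm_num)).mul_prod (hg.integrable (by norm_num))).const_mul 2
  have h12 : Integrable (fun x : α × β => f x.1 ^ 2 + g x.2 ^ 2) (μ.prod ν) := h1.add h2
  have : ∀ x : α × β, (f x.1 + g x.2) ^ 2 = f x.1 ^ 2 + g x.2 ^ 2 + 2 * (f x.1 * g x.2) :=
    fun x => by ring
  simp only [this]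
  rw [integral_add h12 h3, integral_add h1 h2, integral_const_mul, integral_prod_mul, hg0,
    integral_fun_fst (fun a => f a ^ 2), integral_fun_snd (fun b => g b ^ 2)]
  simp

/-! ### Hedged decisions, in place of Fano's inequality -/

/-- A conditional distribution on `Fin M` that puts at least half of its mass on the decision
`l`. -/
noncomputable def decisionWeight {M : ℕ} (k l : Fin M) : ℝ :=
  (if k = l then 1 / 2 else 0) + 1 / (2 * M)

lemma decisionWeight_pos {M : ℕ} (k l : Fin M) : 0 < decisionWeight k l := by
  have : 0 < M := k.pos
  unfold decisionWeight
  split_ifs <;> positivity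

lemma sum_decisionWeight {M : ℕ} (l : Fin M) : ∑ k, decisionWeight k l = 1 := by
  have : (M : ℝ) ≠ 0 := by exact_mod_cast l.pos.ne'
  simp only [decisionWeight, Finset.sum_add_distrib]
  simp
  field_simp
  norm_num

/-- On agreement the weight is at least one half, which costs at most one bit; on disagreement the
uniform half still leaves `1 / (2 * M)`. -/
lemma neg_log_decisionWeight_le {M : ℕ} (k l : Fin M) :
    -Real.log (decisionWeight k l) ≤ Real.log 2 + if k = l then 0 else Real.log M := by
  have hM : (0 : ℝ) < M := by exact_mod_cast k.pos
  rw [← Real.log_inv]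
  unfold decisionWeight
  split_ifs with h
  · rw [add_zero]
    refine Real.log_le_log (by positivity) ?_
    rw [inv_le_comm₀ (by positivity) (by norm_num)]
    have : 0 < 1 / (2 * (M : ℝ)) := by positivity
    linarith
  · rw [← Real.log_mul (by norm_num) hM.ne']
    simp

lemma integrable_comp_of_finite {Ω α : Type*} [MeasurableSpace Ω] [Finite α] [MeasurableSpace α]
    [MeasurableSingletonClass α] {μ : Measure Ω} [IsFiniteMeasure μ] (f : α → ℝ) {X : Ω → α}
    (hX : Measurable X) : Integrable (fun ω => f (X ω)) μ :=
  (integrable_map_measure (measurable_of_finite f).aestronglyMeasurable hX.aemeasurable).1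
    .of_finite

lemma integrable_log_decisionWeight {Ω : Type*} [MeasurableSpace Ω] {μ : Measure Ω}
    [IsFiniteMeasure μ] {M : ℕ} {K L : Ω → Fin M} (hK : Measurable K) (hL : Measurable L) :
    Integrable (fun ω => Real.log (decisionWeight (K ω) (L ω))) μ :=
  integrable_comp_of_finite (fun x : Fin M × Fin M => Real.log (decisionWeight x.1 x.2))
    (hK.prodMk hL)

lemma neg_integral_log_decisionWeight_le {Ω : Type*} [MeasurableSpace Ω] {μ : Measure Ω}
    [IsProbabilityMeasure μ] {M : ℕ} {K L : Ω → Fin M} (hK : Measurable K) (hL : Measurable L) :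
    -∫ ω, Real.log (decisionWeight (K ω) (L ω)) ∂μ ≤
      Real.log 2 + μ.real {ω | K ω ≠ L ω} * Real.log M := by
  have hS : MeasurableSet {ω | K ω ≠ L ω} := (measurableSet_eq_fun hK hL).compl
  have hf {f : Fin M × Fin M → ℝ} : Integrable (fun ω => f (K ω, L ω)) μ :=
    integrable_comp_of_finite f (hK.prodMk hL)
  rw [← integral_neg]
  calc _ ≤ ∫ ω, (Real.log 2 + if K ω = L ω then 0 else Real.log M) ∂μ :=
        integral_mono (hf (f := fun x => -Real.log (decisionWeight x.1 x.2)))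
          (hf (f := fun x => Real.log 2 + if x.1 = x.2 then 0 else Real.log M))
          fun ω => neg_log_decisionWeight_le _ _
    _ = Real.log 2 + ∫ ω, {ω | K ω ≠ L ω}.indicator (fun _ => Real.log M) ω ∂μ := by
        rw [integral_add (integrable_const _)
          (hf (f := fun x => if x.1 = x.2 then 0 else Real.log M))]
        simp [Set.indicator_apply]
    _ = _ := by rw [integral_indicator_const _ hS, smul_eq_mul]

/-! ### Equivocation under a Gaussian coupling -/

lemma entropy_map {Ω Ω' A : Type*} [MeasurableSpace Ω] [MeasurableSpace Ω'] [Fintype A]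
    [MeasurableSpace A] [MeasurableSingletonClass A] {μ : Measure Ω} {f : Ω → Ω'}
    (hf : Measurable f) {K : Ω' → A} (hK : Measurable K) :
    entropy (μ.map f) K = entropy μ (K ∘ f) := by
  unfold entropy
  simp only [map_measureReal_apply hf (hK (measurableSet_singleton _)), Set.preimage_comp]

/-- The gain of a Gaussian estimate over the true Gaussian conditional density. -/
lemma neg_integral_log_iidGaussianPDF_sub_le {Ω : Type*} [MeasurableSpace Ω] {μ : Measure Ω}
    [IsProbabilityMeasure μ] {b τ : ℝ≥0} (hb : b ≠ 0) (hτ : τ ≠ 0) {D W : Ω → Fin n → ℝ}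
    (hD : ∀ i, MemLp (fun ω => D ω i) 2 μ) (hW : ∀ i, MemLp (fun ω => W ω i) 2 μ)
    (hDb : ∑ i, ∫ ω, D ω i ^ 2 ∂μ ≤ n * b) (hWτ : ∑ i, ∫ ω, W ω i ^ 2 ∂μ = n * τ) :
    -∫ ω, (Real.log (iidGaussianPDF n b (D ω)) - Real.log (iidGaussianPDF n τ (W ω))) ∂μ ≤
      n / 2 * Real.log (b / τ) := by
  have hb' : (0 : ℝ) < b := by positivity
  have hτ' : (0 : ℝ) < τ := by positivity
  have h2 := Real.pi_pos
  rw [integral_sub (integrable_log_iidGaussianPDF hb hD) (integrable_log_iidGaussianPDF hτ hW),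
    integral_log_iidGaussianPDF hb hD, integral_log_iidGaussianPDF hτ hW, hWτ,
    Real.log_mul (by positivity) hb'.ne', Real.log_mul (by positivity) hτ'.ne',
    Real.log_div hb'.ne' hτ'.ne']
  -- The quadratic term of `D` is at most `n / 2`, which the quadratic term of `W` compensates
  -- exactly; only the normalising constants remain.
  have h1 : (∑ i, ∫ ω, D ω i ^ 2 ∂μ) / (2 * b) ≤ n / 2 := by
    rw [div_le_div_iff₀ (by positivity) (by norm_num)]
    linarith
  have h3 : n * (τ : ℝ) / (2 * τ) = n / 2 := by field_simp
  rw [h3]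
  linarith

/-- The weight of the key `k` under `decisionWeight`, averaged over the receiver's output `y`, when `y` is estimated by `a z` with a Gaussian error of variance `b`. -/
noncomputable def decisionDensity {M : ℕ} (h : (Fin n → ℝ) → Fin M) (b : ℝ≥0) (a : ℝ)
    (x : Fin M × (Fin n → ℝ)) : ℝ≥0∞ :=
  ∫⁻ y, ENNReal.ofReal (decisionWeight x.1 (h y)) *
    ENNReal.ofReal (iidGaussianPDF n b (y - a • x.2))

@[fun_prop]
lemma measurable_ofReal_decisionWeight {Ω : Type*} [MeasurableSpace Ω] {M : ℕ} {K L : Ω → Fin M}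
    (hK : Measurable K) (hL : Measurable L) :
    Measurable fun ω => ENNReal.ofReal (decisionWeight (K ω) (L ω)) :=
  (measurable_of_finite fun x : Fin M × Fin M => ENNReal.ofReal (decisionWeight x.1 x.2)).comp
    (hK.prodMk hL)

lemma measurable_decisionDensity {M : ℕ} {h : (Fin n → ℝ) → Fin M} (hh : Measurable h) (b : ℝ≥0)
    (a : ℝ) : Measurable (decisionDensity h b a) := by
  refine Measurable.lintegral_prod_right'
    (f := fun p : (Fin M × (Fin n → ℝ)) × (Fin n → ℝ) =>
      ENNReal.ofReal (decisionWeight p.1.1 (h p.2)) *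
        ENNReal.ofReal (iidGaussianPDF n b (p.2 - a • p.1.2))) ?_
  fun_prop

/-- This is the normalisation that `equivocation_le` requires: summing over the key first removes
the decision weights and leaves a translated Gaussian density. -/
lemma sum_decisionDensity {M : ℕ} {h : (Fin n → ℝ) → Fin M} (hh : Measurable h) {b : ℝ≥0}
    (hb : b ≠ 0) (a : ℝ) (z : Fin n → ℝ) : ∑ k, decisionDensity h b a (k, z) = 1 := by
  unfold decisionDensity
  rw [← lintegral_finsetSum _ fun k _ => by fun_prop, ← lintegral_iidGaussianPDF (n := n) hb,
    
    ← lintegral_sub_right_eq_self (fun y => ENNReal.ofReal (iidGaussianPDF n b y)) (a • z)]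
  refine lintegral_congr fun y => ?_
  dsimp only
  rw [← Finset.sum_mul, ← ENNReal.ofReal_sum_of_nonneg fun k _ => (decisionWeight_pos _ _).le,
    sum_decisionWeight, ENNReal.ofReal_one, one_mul]

/-- Equivocation of a key `K` given `Z` when the receiver's output is `S` plus an independent
Gaussian noise of variance `τ`. -/
lemma equivocation_le_decision {Ω : Type*} [MeasurableSpace Ω] {m : Measure Ω}
    [IsProbabilityMeasure m] {M : ℕ} {K : Ω → Fin M} (hK : Measurable K)
    {Z S : Ω → Fin n → ℝ} (hZ : Measurable Z) (hS : Measurable S)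
    {h : (Fin n → ℝ) → Fin M} (hh : Measurable h) {b τ : ℝ≥0} (hb : b ≠ 0) (hτ : τ ≠ 0) {a : ℝ}
    (hint : Integrable (fun x : Ω × (Fin n → ℝ) =>
      Real.log (iidGaussianPDF n b (S x.1 + x.2 - a • Z x.1)) -
        Real.log (iidGaussianPDF n τ x.2)) (m.prod (iidGaussian n τ)))
    (hfin : InformationTheory.klDiv (m.map fun x => (K x, Z x)) ((m.map K).prod (m.map Z)) ≠ ∞) :
    entropy m K * Real.log 2 -
      (InformationTheory.klDiv (m.map fun x => (K x, Z x)) ((m.map K).prod (m.map Z))).toReal ≤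
      -(∫ x, Real.log (decisionWeight (K x.1) (h (S x.1 + x.2))) ∂m.prod (iidGaussian n τ) +
        ∫ x, (Real.log (iidGaussianPDF n b (S x.1 + x.2 - a • Z x.1)) -
          Real.log (iidGaussianPDF n τ x.2)) ∂m.prod (iidGaussian n τ)) := by
  -- Adjoining the innovation does not change the law of `(K, Z)`, so the left side can be computed
  -- on the enlarged space.
  have hμm : (m.prod (iidGaussian n τ)).map Prod.fst = m := by rw [Measure.map_fst_prod]; simp
  obtain ⟨μ, hμ⟩ : ∃ μ, μ = m.prod (iidGaussian n τ) := ⟨_, rfl⟩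
  have : IsProbabilityMeasure μ := by rw [hμ]; infer_instance
  rw [← hμ] at hint hμm ⊢
  have eK : m.map K = μ.map fun x => K x.1 := by
    rw [← hμm, Measure.map_map hK measurable_fst]; rfl
  have eZ : m.map Z = μ.map fun x => Z x.1 := by
    rw [← hμm, Measure.map_map hZ measurable_fst]; rfl
  have eKZ : m.map (fun x => (K x, Z x)) = μ.map fun x => (K x.1, Z x.1) := by
    rw [← hμm, Measure.map_map (hK.prodMk hZ) measurable_fst]; rfl
  have eH : entropy m K = entropy μ fun x => K x.1 := by
    rw [← hμm, entropy_map measurable_fst hK]; rfl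
  rw [eK, eZ, eKZ] at hfin ⊢
  have hF : Integrable (fun x : Ω × (Fin n → ℝ) =>
      Real.log (decisionWeight (K x.1) (h (S x.1 + x.2)))) μ :=
    integrable_log_decisionWeight (by fun_prop) (by fun_prop)
  have hTint := hF.add hint
  rw [eH, ← integral_add hF hint]
  refine equivocation_le (by fun_prop) (by fun_prop) hfin hTint
    (measurable_decisionDensity hh b a) (fun z => (sum_decisionDensity hh hb a z).le) fun g hg => ?_
  have hexp (x : Ω × (Fin n → ℝ)) :
      ENNReal.ofReal (Real.exp (Real.log (decisionWeight (K x.1) (h (S x.1 + x.2))) +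
        (Real.log (iidGaussianPDF n b (S x.1 + x.2 - a • Z x.1)) -
          Real.log (iidGaussianPDF n τ x.2)))) =
      ENNReal.ofReal (decisionWeight (K x.1) (h (S x.1 + x.2))) *
        ENNReal.ofReal (iidGaussianPDF n b (S x.1 + x.2 - a • Z x.1) /
          iidGaussianPDF n τ x.2) := by
    rw [Real.exp_add, Real.exp_sub, Real.exp_log (decisionWeight_pos _ _),
      Real.exp_log (iidGaussianPDF_pos hb _), Real.exp_log (iidGaussianPDF_pos hτ _),
      ENNReal.ofReal_mul (decisionWeight_pos _ _).le]
  have hΦm := measurable_decisionDensity hh b a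
  simp only [hexp]
  rw [hμ, lintegral_prod _ (by fun_prop), lintegral_prod _ (by fun_prop)]
  -- With `x` fixed, the innovation is integrated out. The ratio of densities turns the law of `S x
  -- + W` into the Gaussian law centred at `a • Z x`, which is the one in `decisionDensity`.
  refine le_of_eq (lintegral_congr fun x => ?_)
  simp only
  rw [lintegral_const_mul _ (by fun_prop), lintegral_const, measure_univ, mul_one]
  congr 1
  exact lintegral_iidGaussian_mul_div hτ
    (f := fun y => ENNReal.ofReal (decisionWeight (K x) (h y))) (by fun_prop) (S x) (a • Z x)

/-- Equivocation bound for a key `K` and a signal `V` observed in Gaussian noise by an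
eavesdropper, `Z = V + E`, and by a receiver, `Y = V + c E + W`, with a linear estimate `a Z` of
`Y`. -/
lemma equivocation_le_gaussian {A : Type*} [MeasurableSpace A] {ρ : Measure A}
    [IsProbabilityMeasure ρ] {M : ℕ} {K : A → Fin M} (hK : Measurable K)
    {V : A → Fin n → ℝ} (hV : Measurable V) (hV2 : ∀ i, MemLp (fun x => V x i) 2 ρ)
    {h : (Fin n → ℝ) → Fin M} (hh : Measurable h) {q : ℝ}
    (hq : ∑ i, ∫ x, V x i ^ 2 ∂ρ ≤ n * q) {v b τ : ℝ≥0} (hb : b ≠ 0) (hτ : τ ≠ 0) {a c : ℝ}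
    (hcτ : c ^ 2 * v + τ = 1) (hab : (1 - a) ^ 2 * q + (c - a) ^ 2 * v + τ ≤ b)
    (hfin : InformationTheory.klDiv
      ((ρ.prod (iidGaussian n v)).map fun x => (K x.1, V x.1 + x.2))
      (((ρ.prod (iidGaussian n v)).map fun x => K x.1).prod
        ((ρ.prod (iidGaussian n v)).map fun x => V x.1 + x.2)) ≠ ∞) :
    entropy (ρ.prod (iidGaussian n v)) (fun x => K x.1) * Real.log 2 -
      (InformationTheory.klDiv
        ((ρ.prod (iidGaussian n v)).map fun x => (K x.1, V x.1 + x.2))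
        (((ρ.prod (iidGaussian n v)).map fun x => K x.1).prod
          ((ρ.prod (iidGaussian n v)).map fun x => V x.1 + x.2))).toReal ≤
      n / 2 * Real.log (b / τ) + (Real.log 2 +
        (ρ.prod (iidGaussian n 1)).real {x | K x.1 ≠ h (V x.1 + x.2)} * Real.log M) := by
  obtain ⟨m, hm⟩ : ∃ m, m = ρ.prod (iidGaussian n v) := ⟨_, rfl⟩
  have : IsProbabilityMeasure m := by rw [hm]; infer_instance
  rw [← hm] at hfin ⊢
  obtain ⟨μ, hμ⟩ : ∃ μ, μ = m.prod (iidGaussian n τ) := ⟨_, rfl⟩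
  have : IsProbabilityMeasure μ := by rw [hμ]; infer_instance
  -- The error `Y - a Z` splits into three parts, from `V`, `E` and `W`. The noises are centred and
  -- independent of the rest, so the second moments add.
  have hDi (x : (A × (Fin n → ℝ)) × (Fin n → ℝ)) (i : Fin n) :
      (V x.1.1 + c • x.1.2 + x.2 - a • (V x.1.1 + x.1.2)) i =
        ((1 - a) * V x.1.1 i + (c - a) * x.1.2 i) + x.2 i := by
    simp only [Pi.sub_apply, Pi.add_apply, Pi.smul_apply, smul_eq_mul]
    ring
  have hE2 (i : Fin n) : MemLp (fun x : Fin n → ℝ => (c - a) * x i) 2 (iidGaussian n v) :=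
    (memLp_eval_iidGaussian v i).const_mul _
  have hin2 (i : Fin n) :
      MemLp (fun x : A × (Fin n → ℝ) => (1 - a) * V x.1 i + (c - a) * x.2 i) 2 m := by
    rw [hm]
    exact (((hV2 i).const_mul (1 - a)).comp_fst (iidGaussian n v)).add ((hE2 i).comp_snd ρ)
  have hW2 (i : Fin n) : MemLp (fun x : (A × (Fin n → ℝ)) × (Fin n → ℝ) => x.2 i) 2 μ := by
    rw [hμ]
    exact (memLp_eval_iidGaussian τ i).comp_snd m
  have hD2 (i : Fin n) : MemLp (fun x : (A × (Fin n → ℝ)) × (Fin n → ℝ) =>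
      (V x.1.1 + c • x.1.2 + x.2 - a • (V x.1.1 + x.1.2)) i) 2 μ := by
    simp only [hDi]
    refine MemLp.add ?_ (hW2 i)
    rw [hμ]
    exact (hin2 i).comp_fst (iidGaussian n τ)
  have hDint (i : Fin n) : ∫ x, (V x.1.1 + c • x.1.2 + x.2 - a • (V x.1.1 + x.1.2)) i ^ 2 ∂μ =
      (1 - a) ^ 2 * ∫ x, V x i ^ 2 ∂ρ + (c - a) ^ 2 * v + τ := by
    simp only [hDi]
    rw [hμ, integral_prod_add_sq (hin2 i) (memLp_eval_iidGaussian τ i)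
      (integral_eval_iidGaussian τ i), integral_eval_sq_iidGaussian, hm,
      integral_prod_add_sq ((hV2 i).const_mul (1 - a)) (hE2 i)
      (by rw [integral_const_mul, integral_eval_iidGaussian, mul_zero])]
    simp only [mul_pow, integral_const_mul, integral_eval_sq_iidGaussian]
  have hDb : ∑ i, ∫ x, (V x.1.1 + c • x.1.2 + x.2 - a • (V x.1.1 + x.1.2)) i ^ 2 ∂μ ≤ n * b := by
    simp only [hDint, Finset.sum_add_distrib, ← Finset.mul_sum]
    simp only [Finset.sum_const, Finset.card_univ, Fintype.card_fin, nsmul_eq_mul]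
    calc _ ≤ (1 - a) ^ 2 * (n * q) + n * ((c - a) ^ 2 * v) + n * τ := by
          linarith [mul_le_mul_of_nonneg_left hq (sq_nonneg (1 - a))]
      _ = n * ((1 - a) ^ 2 * q + (c - a) ^ 2 * v + τ) := by ring
      _ ≤ n * b := by gcongr
  have hWτ : ∑ i : Fin n, ∫ x, x.2 i ^ 2 ∂μ = n * τ := by
    have (i : Fin n) : ∫ x, x.2 i ^ 2 ∂μ = τ := by
      rw [hμ, integral_fun_snd (fun y : Fin n → ℝ => y i ^ 2), integral_eval_sq_iidGaussian]
      simp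
    simp [this]
  -- Here `c ^ 2 * v + τ = 1` is used: the coupled output has the receiver's true law jointly with
  -- the sender's data, so the error probability is unchanged.
  have hYlaw : μ.map (fun x => (x.1.1, c • x.1.2 + x.2)) = ρ.prod (iidGaussian n 1) := by
    have h1 := Measure.map_prod_map ρ ((iidGaussian n v).prod (iidGaussian n τ)) measurable_id
      (by fun_prop : Measurable fun p : (Fin n → ℝ) × (Fin n → ℝ) => c • p.1 + p.2)
    rw [map_smul_add_iidGaussian c v τ 1 (by simpa using hcτ), Measure.map_id,
      ← Measure.prodAssoc_prod, Measure.map_map (by fun_prop) (by fun_prop), ← hm, ← hμ] at h1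
    exact h1.symm
  have herr : μ.real {x | K x.1.1 ≠ h (V x.1.1 + c • x.1.2 + x.2)} =
      (ρ.prod (iidGaussian n 1)).real {x | K x.1 ≠ h (V x.1 + x.2)} := by
    have hS : MeasurableSet {x : A × (Fin n → ℝ) | K x.1 ≠ h (V x.1 + x.2)} :=
      (measurableSet_eq_fun (by fun_prop) (by fun_prop)).compl
    rw [← hYlaw, map_measureReal_apply (by fun_prop) hS]
    simp only [add_assoc]
    rfl
  have hF := neg_integral_log_decisionWeight_le (μ := μ) (K := fun x => K x.1.1)
    (L := fun x => h (V x.1.1 + c • x.1.2 + x.2)) (by fun_prop) (by fun_prop)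
  have hG := neg_integral_log_iidGaussianPDF_sub_le hb hτ hD2 hW2 hDb hWτ
  have hGint := (integrable_log_iidGaussianPDF hb hD2).sub (integrable_log_iidGaussianPDF hτ hW2)
  have hle := equivocation_le_decision (m := m) (K := fun x => K x.1)
    (Z := fun x => V x.1 + x.2) (S := fun x => V x.1 + c • x.2) (a := a) (by fun_prop)
    (by fun_prop) (by fun_prop) hh hb hτ (by rw [← hμ]; exact hGint) hfin
  rw [← hμ] at hle
  rw [herr] at hF
  linarith

/-! ### Power of the transmitted signal plus state -/

/-- Cauchy–Schwarz over all letters at once: the energy of `X + t S` is a nonnegative quadratic in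
`t`, and its discriminant bounds the correlation. Independence is not available, because the encoder
sees the state. -/
lemma sum_integral_add_sq_le {Ω : Type*} [MeasurableSpace Ω] {μ : Measure Ω}
    {X S : Ω → Fin n → ℝ} (hX : ∀ i, MemLp (fun ω => X ω i) 2 μ)
    (hS : ∀ i, MemLp (fun ω => S ω i) 2 μ) {A B : ℝ}
    (hA : ∑ i, ∫ ω, X ω i ^ 2 ∂μ ≤ A) (hB : ∑ i, ∫ ω, S ω i ^ 2 ∂μ ≤ B) :
    ∑ i, ∫ ω, (X ω i + S ω i) ^ 2 ∂μ ≤ A + B + 2 * √(A * B) := by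
  have hexp (t : ℝ) : ∑ i, ∫ ω, (X ω i + t * S ω i) ^ 2 ∂μ =
      (∑ i, ∫ ω, S ω i ^ 2 ∂μ) * (t * t) + (2 * ∑ i, ∫ ω, X ω i * S ω i ∂μ) * t +
        ∑ i, ∫ ω, X ω i ^ 2 ∂μ := by
    simp only [Finset.sum_mul, Finset.mul_sum, ← Finset.sum_add_distrib]
    refine Finset.sum_congr rfl fun i _ => ?_
    have h1 := (hX i).integrable_sq
    have h2 := ((hS i).integrable_sq).const_mul (t * t)
    have h3 := ((hX i).integrable_mul (hS i)).const_mul (2 * t)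
    have h23 : Integrable (fun ω => t * t * S ω i ^ 2 + 2 * t * (X ω i * S ω i)) μ := h2.add h3
    calc _ = ∫ ω, (t * t * S ω i ^ 2 + 2 * t * (X ω i * S ω i) + X ω i ^ 2) ∂μ := by
          congr with ω; ring
      _ = t * t * ∫ ω, S ω i ^ 2 ∂μ + 2 * t * ∫ ω, X ω i * S ω i ∂μ + ∫ ω, X ω i ^ 2 ∂μ := by
          rw [integral_add h23 h1, ← integral_const_mul, ← integral_const_mul]
          congr 1
          exact integral_add h2 h3
      _ = _ := by ring
  have hA0 : 0 ≤ ∑ i, ∫ ω, X ω i ^ 2 ∂μ :=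
    Finset.sum_nonneg fun i _ => integral_nonneg fun ω => sq_nonneg _
  have hB0 : 0 ≤ ∑ i, ∫ ω, S ω i ^ 2 ∂μ :=
    Finset.sum_nonneg fun i _ => integral_nonneg fun ω => sq_nonneg _
  have hdisc := discrim_le_zero (a := ∑ i, ∫ ω, S ω i ^ 2 ∂μ)
    (b := 2 * ∑ i, ∫ ω, X ω i * S ω i ∂μ) (c := ∑ i, ∫ ω, X ω i ^ 2 ∂μ) fun t => by
      rw [← hexp]
      exact Finset.sum_nonneg fun i _ => integral_nonneg fun ω => sq_nonneg _
  have hcross : ∑ i, ∫ ω, X ω i * S ω i ∂μ ≤ √(A * B) := by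
    refine Real.le_sqrt_of_sq_le ?_
    have := mul_le_mul hA hB hB0 (hA0.trans hA)
    rw [discrim] at hdisc
    linarith
  have h1 := hexp 1
  simp only [one_mul, mul_one] at h1
  rw [h1]
  linarith

/-! ### Single-code converse -/

namespace KeyCode

/-- The joint law of the state sequence and the sender's randomness. -/
noncomputable def senderLaw (C : KeyCode n) (Q : ℝ≥0) : Measure ((Fin n → ℝ) × C.U) :=
  iidGaussian n Q ⊗ₘ C.randomizer

instance (C : KeyCode n) (Q : ℝ≥0) : IsProbabilityMeasure (C.senderLaw Q) := by
  unfold senderLaw; infer_instance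

/-- The noiseless signal `x + s`. -/
def signal (C : KeyCode n) (x : (Fin n → ℝ) × C.U) : Fin n → ℝ :=
  C.encoder x.2 x.1 + x.1

variable (C : KeyCode n) (P Q Δ : ℝ≥0)

instance : IsProbabilityMeasure (C.law Q Δ) := by
  unfold law; infer_instance

lemma measurable_encoder_swap : Measurable fun x : (Fin n → ℝ) × C.U => C.encoder x.2 x.1 :=
  C.measurable_encoder.comp measurable_swap

lemma measurable_encoder_apply (i : Fin n) :
    Measurable fun x : (Fin n → ℝ) × C.U => C.encoder x.2 x.1 i :=
  (measurable_pi_apply i).comp C.measurable_encoder_swap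

lemma measurable_signal : Measurable C.signal :=
  C.measurable_encoder_swap.add measurable_fst

lemma measurable_senderKey_swap :
    Measurable fun x : (Fin n → ℝ) × C.U => C.senderKey x.2 x.1 :=
  C.measurable_senderKey.comp measurable_swap

lemma map_fst_law : (C.law Q Δ).map Prod.fst = C.senderLaw Q := by
  rw [law, Measure.map_fst_prod]
  simp [senderLaw]

lemma map_receiver_law :
    (C.law Q Δ).map (fun ω => (ω.1, ω.2.1)) = (C.senderLaw Q).prod (iidGaussian n 1) := by
  have h := Measure.map_prod_map (C.senderLaw Q)
    ((iidGaussian n 1).prod (iidGaussian n (1 + Δ))) measurable_id measurable_fst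
  rw [Measure.map_id, Measure.map_fst_prod, measure_univ, one_smul] at h
  exact h.symm

lemma map_eavesdropper_law :
    (C.law Q Δ).map (fun ω => (ω.1, ω.2.2)) = (C.senderLaw Q).prod (iidGaussian n (1 + Δ)) := by
  have h := Measure.map_prod_map (C.senderLaw Q)
    ((iidGaussian n 1).prod (iidGaussian n (1 + Δ))) measurable_id measurable_snd
  rw [Measure.map_id, Measure.map_snd_prod, measure_univ, one_smul] at h
  exact h.symm

variable {C P Q Δ}

lemma memLp_input (h : C.PowerConstraint P Q Δ) (i : Fin n) :
    MemLp (fun x => C.encoder x.2 x.1 i) 2 (C.senderLaw Q) := by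
  rw [memLp_two_iff_integrable_sq (C.measurable_encoder_apply i).aestronglyMeasurable,
    ← C.map_fst_law Q Δ,
    integrable_map_measure ((C.measurable_encoder_apply i).pow_const 2).aestronglyMeasurable
      measurable_fst.aemeasurable]
  exact h.1 i

lemma sum_integral_input_sq_le (hn : 0 < n) (h : C.PowerConstraint P Q Δ) :
    ∑ i, ∫ x, C.encoder x.2 x.1 i ^ 2 ∂C.senderLaw Q ≤ n * P := by
  have hn' : (0 : ℝ) < n := by exact_mod_cast hn
  have h2 := h.2
  rw [div_le_iff₀ hn', mul_comm] at h2
  refine le_trans (le_of_eq (Finset.sum_congr rfl fun i _ => ?_)) h2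
  rw [← C.map_fst_law Q Δ, integral_map measurable_fst.aemeasurable
    ((C.measurable_encoder_apply i).pow_const 2).aestronglyMeasurable]
  rfl

lemma map_fst_senderLaw : (C.senderLaw Q).map Prod.fst = iidGaussian n Q :=
  Measure.fst_compProd _ _

lemma memLp_state (i : Fin n) : MemLp (fun x => x.1 i) 2 (C.senderLaw Q) := by
  have h := memLp_eval_iidGaussian Q i
  rw [← map_fst_senderLaw (C := C)] at h
  exact h.comp_of_map measurable_fst.aemeasurable

lemma integral_state_sq (i : Fin n) : ∫ x, x.1 i ^ 2 ∂C.senderLaw Q = Q := by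
  rw [← integral_eval_sq_iidGaussian Q i, ← map_fst_senderLaw (C := C),
    integral_map measurable_fst.aemeasurable
      (Measurable.aestronglyMeasurable (by fun_prop))]

lemma memLp_signal (h : C.PowerConstraint P Q Δ) (i : Fin n) :
    MemLp (fun x => C.signal x i) 2 (C.senderLaw Q) :=
  (memLp_input h i).add (memLp_state i)

lemma sum_integral_signal_sq_le (hn : 0 < n) (h : C.PowerConstraint P Q Δ) :
    ∑ i, ∫ x, C.signal x i ^ 2 ∂C.senderLaw Q ≤ n * (P + Q + 2 * √(P * Q)) := by
  have := sum_integral_add_sq_le (S := fun x => x.1) (memLp_input h) memLp_state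
    (sum_integral_input_sq_le hn h) (B := n * Q) (by simp [integral_state_sq])
  refine this.trans (le_of_eq ?_)
  rw [show (n * P * (n * Q) : ℝ) = n ^ 2 * (P * Q) by ring, Real.sqrt_mul (by positivity),
    Real.sqrt_sq (by positivity)]
  ring

/-- Equivocation bound for a code, through any Gaussian coupling of the two noises and any linear
estimate of the receiver's output. -/
lemma equivocation_le_coupling (hn : 0 < n) (h : C.PowerConstraint P Q Δ) {b τ : ℝ} (hb : 0 < b)
    (hτ : 0 < τ) {a c : ℝ} (hcτ : c ^ 2 * (1 + Δ) + τ = 1)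
    (hab : (1 - a) ^ 2 * (P + Q + 2 * √(P * Q)) + (c - a) ^ 2 * (1 + Δ) + τ ≤ b)
    (hfin : mutualInfo (C.law Q Δ) C.keyK C.outputE ≠ ∞) :
    (entropy (C.law Q Δ) C.keyK - (mutualInfo (C.law Q Δ) C.keyK C.outputE).toReal) * Real.log 2 ≤
      n / 2 * Real.log (b / τ) + (Real.log 2 +
        (C.law Q Δ).real {ω | C.keyK ω ≠ C.keyL ω} * Real.log C.keyCard) := by
  lift b to ℝ≥0 using hb.le
  lift τ to ℝ≥0 using hτ.le
  have h2 : 0 < Real.log 2 := Real.log_pos (by norm_num)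
  have hK := C.measurable_senderKey_swap
  have hV := C.measurable_signal
  have hh := C.measurable_receiverKey
  have hf : Measurable fun ω : C.Outcome => (ω.1, ω.2.2) := by fun_prop
  have hr : Measurable fun ω : C.Outcome => (ω.1, ω.2.1) := by fun_prop
  have hK1 : Measurable fun x : ((Fin n → ℝ) × C.U) × (Fin n → ℝ) => C.senderKey x.1.2 x.1.1 :=
    hK.comp measurable_fst
  have hZ1 : Measurable fun x : ((Fin n → ℝ) × C.U) × (Fin n → ℝ) => C.signal x.1 + x.2 :=
    (hV.comp measurable_fst).add measurable_snd
  have eH : entropy ((C.senderLaw Q).prod (iidGaussian n (1 + Δ)))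
      (fun x => C.senderKey x.1.2 x.1.1) = entropy (C.law Q Δ) C.keyK := by
    rw [← map_eavesdropper_law, entropy_map hf hK1]; rfl
  have eK : ((C.senderLaw Q).prod (iidGaussian n (1 + Δ))).map (fun x => C.senderKey x.1.2 x.1.1) =
      (C.law Q Δ).map C.keyK := by
    rw [← map_eavesdropper_law, Measure.map_map hK1 hf]; rfl
  have eZ : ((C.senderLaw Q).prod (iidGaussian n (1 + Δ))).map (fun x => C.signal x.1 + x.2) =
      (C.law Q Δ).map C.outputE := by
    rw [← map_eavesdropper_law, Measure.map_map hZ1 hf]; rfl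
  have eKZ : ((C.senderLaw Q).prod (iidGaussian n (1 + Δ))).map
      (fun x => (C.senderKey x.1.2 x.1.1, C.signal x.1 + x.2)) =
      (C.law Q Δ).map fun ω => (C.keyK ω, C.outputE ω) := by
    rw [← map_eavesdropper_law, Measure.map_map (hK1.prodMk hZ1) hf]; rfl
  have eErr : ((C.senderLaw Q).prod (iidGaussian n 1)).real
      {x | C.senderKey x.1.2 x.1.1 ≠ C.receiverKey (C.signal x.1 + x.2)} =
      (C.law Q Δ).real {ω | C.keyK ω ≠ C.keyL ω} := by
    have hS : MeasurableSet {x : ((Fin n → ℝ) × C.U) × (Fin n → ℝ) |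
        C.senderKey x.1.2 x.1.1 ≠ C.receiverKey (C.signal x.1 + x.2)} :=
      (measurableSet_eq_fun hK1 (hh.comp hZ1)).compl
    rw [← map_receiver_law C Q Δ, map_measureReal_apply hr hS]
    rfl
  have hkl : InformationTheory.klDiv ((C.law Q Δ).map fun ω => (C.keyK ω, C.outputE ω))
      (((C.law Q Δ).map C.keyK).prod ((C.law Q Δ).map C.outputE)) ≠ ∞ := by
    intro htop
    rw [mutualInfo, htop] at hfin
    exact hfin (ENNReal.top_div_of_ne_top ENNReal.ofReal_ne_top)
  have := equivocation_le_gaussian hK hV (memLp_signal h) hh (sum_integral_signal_sq_le hn h)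
    (v := 1 + Δ) (NNReal.coe_pos.1 hb).ne' (NNReal.coe_pos.1 hτ).ne' (a := a)
    (c := c) (by push_cast; exact hcτ) (by push_cast; exact hab)
    (by rw [eK, eZ, eKZ]; exact hkl)
  rw [eH, eK, eZ, eKZ, eErr] at this
  rw [mutualInfo, ENNReal.toReal_div, ENNReal.toReal_ofReal h2.le, sub_mul, div_mul_cancel₀ _ h2.ne']
  exact this

lemma equivocation_le_capacityBound (hn : 0 < n) (h : C.PowerConstraint P Q Δ)
    (hfin : mutualInfo (C.law Q Δ) C.keyK C.outputE ≠ ∞) :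
    (entropy (C.law Q Δ) C.keyK - (mutualInfo (C.law Q Δ) C.keyK C.outputE).toReal) * Real.log 2 ≤
      n / 2 * Real.log (1 + Δ * (P + Q + 2 * √(P * Q)) / (P + Q + 1 + Δ + 2 * √(P * Q))) +
        (Real.log 2 + (C.law Q Δ).real {ω | C.keyK ω ≠ C.keyL ω} * Real.log C.keyCard) := by
  -- For `Δ = 0` the degraded coupling has `τ = 0`, so the innovation has no density.
  rcases eq_or_ne Δ 0 with rfl | hΔ
  · -- let the correlation `c` of the two noises tend to `1`
    have hlim : Tendsto (fun c : ℝ => n / 2 * Real.log (2 / (1 + c)) + (Real.log 2 +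
        (C.law Q 0).real {ω | C.keyK ω ≠ C.keyL ω} * Real.log C.keyCard)) (𝓝[<] 1)
        (𝓝 (n / 2 * Real.log (2 / (1 + 1)) + (Real.log 2 +
          (C.law Q 0).real {ω | C.keyK ω ≠ C.keyL ω} * Real.log C.keyCard))) := by
      refine tendsto_nhdsWithin_of_tendsto_nhds (ContinuousAt.tendsto ?_)
      refine (ContinuousAt.mul continuousAt_const (ContinuousAt.log ?_ (by norm_num))).add
        continuousAt_const
      exact continuousAt_const.div (continuousAt_const.add continuousAt_id) (by norm_num)
    have hle := ge_of_tendsto hlim (b := (entropy (C.law Q 0) C.keyK -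
        (mutualInfo (C.law Q 0) C.keyK C.outputE).toReal) * Real.log 2) ?_
    · norm_num at hle ⊢
      exact hle
    · filter_upwards [Ioo_mem_nhdsLT (show (0 : ℝ) < 1 by norm_num)] with c hc
      have hτ : 0 < 1 - c ^ 2 := by nlinarith [hc.1, hc.2]
      -- With `a = 1` the signal cancels from `Y - Z`, and the error is `(1 - c) ^ 2 + (1 - c ^ 2) =
      -- 2 * (1 - c)`.
      have hb : 0 < 2 * (1 - c) := by linarith [hc.2]
      have := equivocation_le_coupling hn h hb hτ (a := 1) (c := c)
        (by simp) (by simp; linarith) hfin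
      have he : 2 * (1 - c) / (1 - c ^ 2) = 2 / (1 + c) := by
        rw [div_eq_div_iff hτ.ne' (by linarith [hc.1])]; ring
      simpa [he] using this
  · have hΔ' : (0 : ℝ) < Δ := by positivity
    set q : ℝ := P + Q + 2 * √(P * Q) with hq
    have hq0 : 0 ≤ q := by positivity
    have hτ : 0 < (Δ : ℝ) / (1 + Δ) := by positivity
    have hb : 0 < (1 + q) * Δ / (1 + q + Δ) := by positivity
    -- This `c` gives the noises covariance `1`, so that `Z` is `Y` plus independent noise of
    -- variance `Δ`. At signal power `q`, `Y` has variance `1 + q`, which is also its covariance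
    -- with `Z`; hence the least-squares coefficient `a` and error `b`.
    have := equivocation_le_coupling hn h hb hτ (a := (1 + q) / (1 + q + Δ))
      (c := 1 / (1 + Δ)) (by field_simp)
      (by
        rw [← hq]
        refine le_of_eq ?_
        field_simp
        ring) hfin
    have he : 1 + Δ * q / (P + Q + 1 + Δ + 2 * √(P * Q)) =
        (1 + q) * Δ / (1 + q + Δ) / (Δ / (1 + Δ)) := by
      rw [show (P + Q + 1 + Δ + 2 * √(P * Q) : ℝ) = 1 + q + Δ by rw [hq]; ring]
      field_simp
      ring
    rw [he]
    exact this

end KeyCode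

/-! ### Passage to the limit in the block length -/

lemma Achievable.le_capacityBound {P Q Δ : ℝ≥0} {R : ℝ} (hR : Achievable P Q Δ R) :
    R ≤ 1 / 2 * Real.logb 2
      (1 + Δ * (P + Q + 2 * √(P * Q)) / (P + Q + 1 + Δ + 2 * √(P * Q))) := by
  obtain ⟨C, ε, c, hε, hC⟩ := hR
  set G : ℝ := 1 + Δ * (P + Q + 2 * √(P * Q)) / (P + Q + 1 + Δ + 2 * √(P * Q)) with hG
  have h2 : 0 < Real.log 2 := Real.log_pos (by norm_num)
  -- The term `1 / n` is the bit lost by hedging. In `2 + c`, the `2` collects the slacks in entropy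
  -- and leakage, and `c` comes from error probability times key length.
  have hlim : Tendsto (fun n : ℕ => 1 / 2 * Real.logb 2 G + 1 / (n : ℝ) + ε n * (2 + c)) atTop
      (𝓝 (1 / 2 * Real.logb 2 G)) := by
    simpa using (tendsto_const_nhds.add tendsto_one_div_atTop_nhds_zero_nat).add
      (hε.mul_const (2 + c))
  refine ge_of_tendsto hlim ?_
  filter_upwards [eventually_gt_atTop 0] with n hn
  obtain ⟨hP, hM, herr, hH, hI⟩ := hC n hn
  have hn' : (0 : ℝ) < n := by exact_mod_cast hn
  -- Nonnegativity of `ε n` comes from the error bound; without it `ENNReal.ofReal (ε n)` would be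
  -- truncated to zero.
  have hε0 : 0 ≤ ε n := measureReal_nonneg.trans herr
  have hfin : mutualInfo ((C n).law Q Δ) (C n).keyK (C n).outputE ≠ ∞ := by
    intro htop
    rw [htop, ENNReal.top_div_of_ne_top (ENNReal.natCast_ne_top n)] at hI
    exact ENNReal.ofReal_ne_top (top_le_iff.1 hI)
  have hI' : (mutualInfo ((C n).law Q Δ) (C n).keyK (C n).outputE).toReal ≤ ε n * n := by
    have := ENNReal.toReal_mono ENNReal.ofReal_ne_top hI
    rwa [ENNReal.toReal_div, ENNReal.toReal_ofReal hε0, ENNReal.toReal_natCast,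
      div_le_iff₀ hn'] at this
  rw [le_div_iff₀ hn'] at hH
  have hpos : 0 < (C n).keyCard := by
    obtain ⟨ω⟩ : Nonempty (C n).Outcome := nonempty_of_isProbabilityMeasure ((C n).law Q Δ)
    exact ((C n).keyK ω).pos
  have hM1 : (1 : ℝ) ≤ (C n).keyCard := by exact_mod_cast hpos
  have hlogM : Real.log (C n).keyCard ≤ c * n * Real.log 2 := by
    rw [← Real.log_rpow (by norm_num)]
    exact Real.log_le_log (by linarith) hM
  have hmain := KeyCode.equivocation_le_capacityBound hn hP hfin
  rw [← hG] at hmain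
  have hF : ((C n).law Q Δ).real {ω | (C n).keyK ω ≠ (C n).keyL ω} * Real.log (C n).keyCard ≤
      ε n * (c * n * Real.log 2) :=
    mul_le_mul herr hlogM (Real.log_nonneg hM1) hε0
  have hHI : ((R - ε n) * n - ε n * n) * Real.log 2 ≤
      (entropy ((C n).law Q Δ) (C n).keyK -
        (mutualInfo ((C n).law Q Δ) (C n).keyK (C n).outputE).toReal) * Real.log 2 :=
    mul_le_mul_of_nonneg_right (sub_le_sub hH hI') h2.le
  have hlog : Real.log G = Real.logb 2 G * Real.log 2 := by
    rw [Real.logb, div_mul_cancel₀ _ h2.ne']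
  rw [hlog] at hmain
  refine le_of_mul_le_mul_right ?_ (mul_pos hn' h2)
  have hinv : 1 / (n : ℝ) * (n * Real.log 2) = Real.log 2 := by field_simp
  rw [add_mul, add_mul, hinv]
  linarith

end DirtyPaper

theorem mainTheorem8 (P Q Δ : ℝ≥0) :
    DirtyPaper.secretKeyCapacity P Q Δ ≤
      ((1 / 2 * Real.logb 2
        (1 + (Δ : ℝ) * (P + Q + 2 * Real.sqrt (P * Q)) /
          (P + Q + 1 + Δ + 2 * Real.sqrt (P * Q))) : ℝ) : EReal) := by
  refine sSup_le ?_
  rintro r ⟨R, hR, rfl⟩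
  exact EReal.coe_le_coe_iff.2 hR.le_capacityBound
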